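/- Let $k$ be a field of characteristic $p>2$ and let $(X,\omega)$ be a smooth symplectic variety (or just smooth $k$-scheme) over $k$, i.e. $\omega$ is a closed nondegenerate global section of $\Omega^2_X$. For a smooth $k$-scheme $Z$, let $H^1(Z,\Omega^{\le 1})$ denote the group of classes of Zariski-locally defined $1$-forms modulo exact forms, that is, the group of global sections of the sheaf $\Omega^1_Z/d\mathcal O_Z$ (so that the class of a $1$-form vanishes if and only if the form is Zariski-locally exact). Let $[\eta]\in H^1(X,\Omega^{\le1})$ be a class with $d[\eta]=\omega$. For a local function $f$ on $X$ let $H_f$ be its Hamiltonian vector field, normalised by $i_{H_f}\omega=-df$, let $\{f,g\}=H_f(g)$, and let the restricted operation on $\mathcal O_X$ be given by $$f^{[p]} \;=\; i^{[p]}_{H_f}\eta \;=\; i_{H_f^{[p]}}\,\eta-H_f^{\,p-1}\bigl(i_{H_f}\eta\bigr),$$ where $\eta$ is any $1$-form locally representing $[\eta]$ and $\partial^{[p]}=\partial\circ\dots\circ\partial$ ($p$ times) is the $p$-th power of a derivation $\partial$. Let $i\colon Y\hookrightarrow X$ be a smooth closed Lagrangian subvariety, i.e. $\omega|_Y=0$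 and the ideal sheaf $I$ of $Y$ satisfies $\{I,I\}\subseteq I$. Then the following are equivalent: 1. $I$ is stable under the restricted operation, i.e. $f^{[p]}\in I$ for every local section $f$ of $I$; 2. the restriction $[\eta]|_Y$ is zero in $H^1(Y,\Omega^{\le1})$, i.e. the restrictions to $Y$ of the $1$-forms locally representing $[\eta]$ are Zariski-locally exact. -/

import Mathlib

open AlgebraicGeometry CategoryTheory TopologicalSpace Opposite
open scoped KaehlerDifferential TensorProduct

universe u

namespace RestrictedSymplectic

noncomputable section Algebra

section Derivations

variable {k A : Type*} [Field k] [CommRing A] [Algebra k A]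

lemma pow_leibniz (p : ℕ) [hp : Fact p.Prime] [CharP k p] (D : Derivation k A A) (a b : A) :
    ((D : A →ₗ[k] A) ^ p) (a * b) =
      a * ((D : A →ₗ[k] A) ^ p) b + b * ((D : A →ₗ[k] A) ^ p) a := by
  set L : A →ₗ[k] A := (D : A →ₗ[k] A) with hL
  set x : Module.End k (A ⊗[k] A) := TensorProduct.map L LinearMap.id
  set y : Module.End k (A ⊗[k] A) := TensorProduct.map LinearMap.id L
  have hxy : Commute x y := by
    change x * y = y * x
    ext s t
    simp [x, y]
  have hx : ∀ n, x ^ n = TensorProduct.map (L ^ n) LinearMap.id := fun n => by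
    rw [TensorProduct.map_pow]; congr 1; exact (one_pow n : (1 : Module.End k A) ^ n = 1)
  have hy : ∀ n, y ^ n = TensorProduct.map LinearMap.id (L ^ n) := fun n => by
    rw [TensorProduct.map_pow]; congr 1; exact (one_pow n : (1 : Module.End k A) ^ n = 1)
  have key : ∀ n : ℕ, ∀ t, (L ^ n) (LinearMap.mul' k A t) =
      LinearMap.mul' k A (((x + y) ^ n) t) := by
    intro n
    induction n with
    | zero => intro t; simp
    | succ n ih =>
      intro t
      have h1 : L (LinearMap.mul' k A t) = LinearMap.mul' k A ((x + y) t) := by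
        induction t with
        | zero => simp
        | add t s ht hs => simp only [map_add, ht, hs]
        | tmul s t => simp [x, y, hL]; ring
      rw [pow_succ, pow_succ, Module.End.mul_apply, Module.End.mul_apply, h1, ih]
  obtain ⟨r, hr⟩ := hxy.exists_add_pow_prime_eq hp.out
  have hzero : ((p : Module.End k (A ⊗[k] A))) = 0 := by
    rw [← map_natCast (algebraMap k _), CharP.cast_eq_zero, map_zero]
  have := key p (a ⊗ₜ b)
  rw [hr, hzero] at this
  simp [hx, hy] at this
  rw [this]; ring

/-- The `p`-th power `∂^[p]` of a derivation `∂` in characteristic `p`. -/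
def pthPower (p : ℕ) [Fact p.Prime] [CharP k p] (D : Derivation k A A) : Derivation k A A :=
  Derivation.mk' ((D : A →ₗ[k] A) ^ p) (fun a b => by simpa using pow_leibniz p D a b)

lemma pthPower_apply (p : ℕ) [Fact p.Prime] [CharP k p] (D : Derivation k A A) (a : A) :
    pthPower p D a = D^[p] a := by
  change ((D : A →ₗ[k] A) ^ p) a = _
  rw [Module.End.pow_apply]; rfl

/-- Contraction `i_∂ α` of a `1`-form with a vector field. -/
abbrev contractOne (D : Derivation k A A) : Ω[A⁄k] →ₗ[A] A := D.liftKaehlerDifferential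

/-- Contraction `i_∂ : Ω² → Ω¹`, `i_∂ (α ∧ β) = (i_∂ α) β - (i_∂ β) α`. -/
def contractTwo (D : Derivation k A A) : ⋀[A]^2 Ω[A⁄k] →ₗ[A] Ω[A⁄k] :=
  exteriorPower.alternatingMapLinearEquiv
    { toFun := fun v => contractOne D (v 0) • v 1 - contractOne D (v 1) • v 0
      map_update_add' := by
        intro _ v i x y
        fin_cases i <;> simp [add_smul] <;> abel
      map_update_smul' := by
        intro _ v i c x
        fin_cases i <;> simp [mul_smul, smul_sub, smul_comm c]
      map_eq_zero_of_eq' := by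
        intro v i j h hij
        fin_cases i <;> fin_cases j <;> simp_all }

/-- The wedge product of two `1`-forms. -/
def wedge (α β : Ω[A⁄k]) : ⋀[A]^2 Ω[A⁄k] := exteriorPower.ιMulti A 2 ![α, β]

lemma update_left {M : Type*} (α β x : M) : Function.update ![α, β] 0 x = ![x, β] := by
  ext i; fin_cases i <;> rfl

lemma update_right {M : Type*} (α β x : M) : Function.update ![α, β] 1 x = ![α, x] := by
  ext i; fin_cases i <;> rfl

lemma wedge_add_left (α α' β : Ω[A⁄k]) : wedge (α + α') β = wedge α β + wedge α' β := by
  have := (exteriorPower.ιMulti A 2 (M := Ω[A⁄k])).map_update_add ![α, β] 0 α α'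
  rwa [update_left, update_left, update_left] at this

lemma wedge_smul_left (a : A) (α β : Ω[A⁄k]) : wedge (a • α) β = a • wedge α β := by
  have := (exteriorPower.ιMulti A 2 (M := Ω[A⁄k])).map_update_smul ![α, β] 0 a α
  rwa [update_left, update_left] at this

lemma wedge_add_right (α β β' : Ω[A⁄k]) : wedge α (β + β') = wedge α β + wedge α β' := by
  have := (exteriorPower.ιMulti A 2 (M := Ω[A⁄k])).map_update_add ![α, β] 1 β β'
  rwa [update_right, update_right, update_right] at this

lemma wedge_smul_right (a : A) (α β : Ω[A⁄k]) : wedge α (a • β) = a • wedge α β := by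
  have := (exteriorPower.ιMulti A 2 (M := Ω[A⁄k])).map_update_smul ![α, β] 1 a β
  rwa [update_right, update_right] at this

lemma wedge_self (α : Ω[A⁄k]) : wedge α α = 0 :=
  (exteriorPower.ιMulti A 2 (M := Ω[A⁄k])).map_eq_zero_of_eq ![α, α] (i := 0) (j := 1) rfl
    (by simp)

lemma wedge_swap (α β : Ω[A⁄k]) : wedge β α = - wedge α β := by
  have h := wedge_self (α + β)
  rw [wedge_add_left, wedge_add_right, wedge_add_right, wedge_self, wedge_self] at h
  rw [eq_neg_iff_add_eq_zero, add_comm]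
  simpa using h

lemma wedge_zero_left (β : Ω[A⁄k]) : wedge 0 β = 0 := by
  simpa using wedge_smul_left (0 : A) 0 β

lemma wedge_zero_right (β : Ω[A⁄k]) : wedge β 0 = 0 := by
  simpa using wedge_smul_right (0 : A) β 0

lemma contractTwo_wedge (D : Derivation k A A) (α β : Ω[A⁄k]) :
    contractTwo D (wedge α β) = contractOne D α • β - contractOne D β • α := by
  simp [contractTwo, wedge]

/-- The restricted contraction `i^[p]_∂ α = i_{∂^[p]} α - L_∂^{p-1} i_∂ α` of a `1`-form; the Lie
derivative of a function is `L_∂ g = ∂ g`. -/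
def restrictedContraction (p : ℕ) [Fact p.Prime] [CharP k p] (D : Derivation k A A)
    (α : Ω[A⁄k]) : A :=
  contractOne (pthPower p D) α - D^[p - 1] (contractOne D α)


/-- `(a, b) ↦ da ∧ db`, as a map which sends the formal sum `∑ aᵢ [bᵢ]` to `∑ daᵢ ∧ dbᵢ`. -/
def dOneAux : (A →₀ A) →+ ⋀[A]^2 Ω[A⁄k] :=
  Finsupp.liftAddHom fun b =>
    { toFun := fun a => wedge (KaehlerDifferential.D k A a) (KaehlerDifferential.D k A b)
      map_zero' := by simp [wedge_zero_left]
      map_add' := by simp [wedge_add_left] }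
lemma dOneAux_single (a b : A) : dOneAux (k := k) (Finsupp.single b a) =
    wedge (KaehlerDifferential.D k A a) (KaehlerDifferential.D k A b) := by
  rw [dOneAux, Finsupp.liftAddHom_apply_single]; rfl

lemma dOneAux_smul_of_mem (a : A) (x : A →₀ A) :
    dOneAux (k := k) (a • x) = a • dOneAux x +
      wedge (KaehlerDifferential.D k A a) (Finsupp.linearCombination A (KaehlerDifferential.D k A) x) := by
  induction x using Finsupp.induction_linear with
  | zero => simp [wedge_zero_right]
  | add x y hx hy =>
    rw [smul_add, map_add, map_add, map_add, hx, hy, wedge_add_right, smul_add]; abel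
  | single b c =>
    rw [Finsupp.smul_single, dOneAux_single, dOneAux_single, smul_eq_mul, Derivation.leibniz,
      wedge_add_left, wedge_smul_left, wedge_smul_left, Finsupp.linearCombination_single,
      wedge_smul_right]

lemma dOneAux_eq_zero (x : A →₀ A) (hx : x ∈ KaehlerDifferential.kerTotal k A) :
    dOneAux (k := k) x = 0 := by
  refine Submodule.span_induction ?_ (by simp) (fun x y _ _ hx hy => by rw [map_add, hx, hy, add_zero])
    (fun a x hx h => ?_) hx
  · rintro _ ((⟨⟨x, y⟩, rfl⟩ | ⟨⟨x, y⟩, rfl⟩) | ⟨x, rfl⟩)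
    · simp [dOneAux_single, wedge_zero_left]
    · simp only [map_sub, map_add, dOneAux_single, Derivation.map_one_eq_zero,
        wedge_zero_left, sub_zero]
      rw [wedge_swap, neg_add_cancel]
    · simp [dOneAux_single, wedge_zero_left]
  · have h0 : Finsupp.linearCombination A (KaehlerDifferential.D k A) x = 0 := by
      have := (KaehlerDifferential.kerTotal_eq k A).ge hx
      simpa using this
    rw [dOneAux_smul_of_mem, h, h0, smul_zero, wedge_zero_right, add_zero]

/-- The exterior derivative `d : Ω¹ → Ω²`, the additive map with `d (a db) = da ∧ db`. -/
def dOne : Ω[A⁄k] →+ ⋀[A]^2 Ω[A⁄k] :=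
  (QuotientAddGroup.lift (KaehlerDifferential.kerTotal k A).toAddSubgroup dOneAux
    (fun x hx => dOneAux_eq_zero x hx)).comp
  (KaehlerDifferential.quotKerTotalEquiv k A).symm.toLinearMap.toAddMonoidHom

lemma dOne_smul_D (a b : A) : dOne (a • KaehlerDifferential.D k A b) =
    wedge (KaehlerDifferential.D k A a) (KaehlerDifferential.D k A b) := by
  have : (KaehlerDifferential.quotKerTotalEquiv k A).symm (a • KaehlerDifferential.D k A b) =
      Submodule.Quotient.mk (Finsupp.single b a) := by
    rw [LinearEquiv.symm_apply_eq]
    exact (Finsupp.linearCombination_single A a b).symm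
  have h2 : dOne (a • KaehlerDifferential.D k A b) =
      QuotientAddGroup.lift (KaehlerDifferential.kerTotal k A).toAddSubgroup dOneAux
        (fun x hx => dOneAux_eq_zero x hx)
        ((KaehlerDifferential.quotKerTotalEquiv k A).symm (a • KaehlerDifferential.D k A b)) := rfl
  rw [h2, this]
  exact dOneAux_single a b

end Derivations

section Maps

variable {k A B : Type*} [Field k] [CommRing A] [Algebra k A] [CommRing B] [Algebra k B]

/-- The pullback of `1`-forms along `φ : A → B`; it sends `a db` to `φ(a) dφ(b)`. -/
def mapOne (φ : A →ₐ[k] B) : Ω[A⁄k] →ₗ[k] Ω[B⁄k] :=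
  letI := φ.toRingHom.toAlgebra
  haveI : IsScalarTower k A B := IsScalarTower.of_algebraMap_eq fun r => (φ.commutes r).symm
  (KaehlerDifferential.map k k A B).restrictScalars k

lemma mapOne_smul (φ : A →ₐ[k] B) (a : A) (α : Ω[A⁄k]) :
    mapOne φ (a • α) = φ a • mapOne φ α := by
  let := φ.toRingHom.toAlgebra
  have : IsScalarTower k A B := IsScalarTower.of_algebraMap_eq fun r => (φ.commutes r).symm
  change KaehlerDifferential.map k k A B (a • α) = _
  rw [map_smul, ← algebraMap_smul B]; rfl

lemma mapOne_D (φ : A →ₐ[k] B) (a : A) :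
    mapOne φ (KaehlerDifferential.D k A a) = KaehlerDifferential.D k B (φ a) := by
  let := φ.toRingHom.toAlgebra
  have : IsScalarTower k A B := IsScalarTower.of_algebraMap_eq fun r => (φ.commutes r).symm
  exact KaehlerDifferential.map_D k k A B a

lemma mapOne_comp {C : Type*} [CommRing C] [Algebra k C] (φ : A →ₐ[k] B) (ψ : B →ₐ[k] C) (χ : A →ₐ[k] C)
    (h : ∀ a, ψ (φ a) = χ a) (α : Ω[A⁄k]) : mapOne ψ (mapOne φ α) = mapOne χ α := by
  have hα : α ∈ Submodule.span A (Set.range (KaehlerDifferential.D k A)) := by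
    rw [KaehlerDifferential.span_range_derivation]; trivial
  induction hα using Submodule.span_induction with
  | mem x hx => obtain ⟨a, rfl⟩ := hx; simp [mapOne_D, h]
  | zero => simp
  | add x y _ _ hx hy => simp only [map_add, hx, hy]
  | smul a x _ hx => rw [mapOne_smul, mapOne_smul, mapOne_smul, hx, h]

/-- The pullback of `2`-forms along `φ : A → B`; it sends `α ∧ β` to `φ(α) ∧ φ(β)`. -/
def mapTwo (φ : A →ₐ[k] B) : ⋀[A]^2 Ω[A⁄k] →+ ⋀[B]^2 Ω[B⁄k] :=
  letI : Module A (⋀[B]^2 Ω[B⁄k]) := Module.compHom _ φ.toRingHom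
  (exteriorPower.alternatingMapLinearEquiv (R := A) (M := Ω[A⁄k]) (N := ⋀[B]^2 Ω[B⁄k]) (n := 2)
    { toFun := fun v => wedge (mapOne φ (v 0)) (mapOne φ (v 1))
      map_update_add' := by
        intro _ v i x y
        fin_cases i <;> simp [wedge_add_left, wedge_add_right]
      map_update_smul' := by
        intro _ v i c x
        have h : ∀ y : ⋀[B]^2 Ω[B⁄k], c • y = φ c • y := fun _ => rfl
        fin_cases i <;> simp [wedge_smul_left, wedge_smul_right, mapOne_smul, h]
      map_eq_zero_of_eq' := by
        intro v i j h hij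
        fin_cases i <;> fin_cases j <;> simp_all [wedge_self] }).toAddMonoidHom

lemma mapTwo_wedge (φ : A →ₐ[k] B) (α β : Ω[A⁄k]) :
    mapTwo φ (wedge α β) = wedge (mapOne φ α) (mapOne φ β) := by
  let : Module A (⋀[B]^2 Ω[B⁄k]) := Module.compHom _ φ.toRingHom
  exact exteriorPower.alternatingMapLinearEquiv_apply_ιMulti (R := A) (M := Ω[A⁄k])
    (N := ⋀[B]^2 Ω[B⁄k]) (n := 2) _ ![α, β]

lemma mapTwo_smul (φ : A →ₐ[k] B) (a : A) (w : ⋀[A]^2 Ω[A⁄k]) :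
    mapTwo φ (a • w) = φ a • mapTwo φ w := by
  let : Module A (⋀[B]^2 Ω[B⁄k]) := Module.compHom _ φ.toRingHom
  exact (exteriorPower.alternatingMapLinearEquiv (R := A) (M := Ω[A⁄k]) (N := ⋀[B]^2 Ω[B⁄k])
    (n := 2) _).map_smul a w

lemma contractOne_mapOne (φ : A →ₐ[k] B) (D : Derivation k A A) (E : Derivation k B B)
    (h : ∀ a, E (φ a) = φ (D a)) (α : Ω[A⁄k]) :
    contractOne E (mapOne φ α) = φ (contractOne D α) := by
  have hα : α ∈ Submodule.span A (Set.range (KaehlerDifferential.D k A)) := by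
    rw [KaehlerDifferential.span_range_derivation]; trivial
  induction hα using Submodule.span_induction with
  | mem x hx => obtain ⟨a, rfl⟩ := hx; simp [mapOne_D, h]
  | zero => simp
  | add x y _ _ hx hy => simp only [map_add, hx, hy]
  | smul a x _ hx => rw [mapOne_smul, map_smul, map_smul, hx]; simp

lemma two_forms_induction {P : ⋀[A]^2 Ω[A⁄k] → Prop} (h0 : P 0)
    (hadd : ∀ x y, P x → P y → P (x + y)) (hsmul : ∀ (a : A) x, P x → P (a • x))
    (hw : ∀ α β, P (wedge α β)) (w : ⋀[A]^2 Ω[A⁄k]) : P w := by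
  have hmem : w ∈ Submodule.span A (Set.range (exteriorPower.ιMulti A 2 (M := Ω[A⁄k]))) := by
    rw [exteriorPower.ιMulti_span]; trivial
  induction hmem using Submodule.span_induction with
  | mem x hx =>
    obtain ⟨v, rfl⟩ := hx
    have : v = ![v 0, v 1] := by ext i; fin_cases i <;> rfl
    rw [this]; exact hw _ _
  | zero => exact h0
  | add x y _ _ hx hy => exact hadd x y hx hy
  | smul a x _ hx => exact hsmul a x hx

lemma contractTwo_mapTwo (φ : A →ₐ[k] B) (D : Derivation k A A) (E : Derivation k B B)
    (h : ∀ a, E (φ a) = φ (D a)) (w : ⋀[A]^2 Ω[A⁄k]) :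
    contractTwo E (mapTwo φ w) = mapOne φ (contractTwo D w) := by
  induction w using two_forms_induction with
  | h0 => simp
  | hadd x y hx hy => simp only [map_add, hx, hy]
  | hsmul a x hx => rw [mapTwo_smul, map_smul, map_smul, hx, mapOne_smul]
  | hw α β =>
    rw [mapTwo_wedge, contractTwo_wedge, contractTwo_wedge, map_sub, mapOne_smul, mapOne_smul,
      contractOne_mapOne φ D E h, contractOne_mapOne φ D E h]

lemma iterate_map_eq (φ : A →ₐ[k] B) (D : Derivation k A A) (E : Derivation k B B)
    (h : ∀ a, E (φ a) = φ (D a)) (n : ℕ) (a : A) : E^[n] (φ a) = φ (D^[n] a) := by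
  induction n generalizing a with
  | zero => rfl
  | succ n ih => rw [Function.iterate_succ_apply, Function.iterate_succ_apply, h, ih]

variable (p : ℕ) [Fact p.Prime] [CharP k p]

lemma restrictedContraction_mapOne (φ : A →ₐ[k] B) (D : Derivation k A A) (E : Derivation k B B)
    (h : ∀ a, E (φ a) = φ (D a)) (α : Ω[A⁄k]) :
    restrictedContraction p E (mapOne φ α) = φ (restrictedContraction p D α) := by
  have h' : ∀ a, pthPower p E (φ a) = φ (pthPower p D a) := fun a => by
    rw [pthPower_apply, pthPower_apply, iterate_map_eq φ D E h]
  rw [restrictedContraction, restrictedContraction, contractOne_mapOne φ _ _ h',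
    contractOne_mapOne φ _ _ h, iterate_map_eq φ D E h, map_sub]

lemma restrictedContraction_add_D (D : Derivation k A A) (α : Ω[A⁄k]) (g : A) :
    restrictedContraction p D (α + KaehlerDifferential.D k A g) = restrictedContraction p D α := by
  have hp : p = p - 1 + 1 := (Nat.succ_pred_eq_of_pos (Fact.out : p.Prime).pos).symm
  have hadd : ∀ (n : ℕ) (a b : A), D^[n] (a + b) = D^[n] a + D^[n] b := fun n a b => by
    induction n generalizing a b with
    | zero => rfl
    | succ n ih => simp only [Function.iterate_succ_apply, map_add, ih]
  rw [restrictedContraction, restrictedContraction, map_add, map_add, hadd]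
  have : contractOne (pthPower p D) (KaehlerDifferential.D k A g) =
      D^[p - 1] (contractOne D (KaehlerDifferential.D k A g)) := by
    simp only [Derivation.liftKaehlerDifferential_comp_D, pthPower_apply]
    conv_lhs => rw [hp]
    rw [Function.iterate_succ_apply]
  rw [this]; abel

/-- Vector fields extend uniquely along formally étale maps. -/
lemma exists_extend (φ : A →ₐ[k] B) (hφ : φ.toRingHom.FormallyEtale) (D : Derivation k A A) :
    ∃ E : Derivation k B B, ∀ a, E (φ a) = φ (D a) := by
  let := φ.toRingHom.toAlgebra
  have : IsScalarTower k A B := IsScalarTower.of_algebraMap_eq fun r => (φ.commutes r).symm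
  have : Algebra.FormallyEtale A B := hφ
  let e := KaehlerDifferential.tensorKaehlerEquivOfFormallyEtale k A B
  let l : Ω[A⁄k] →ₗ[A] B := (Algebra.linearMap A B) ∘ₗ contractOne D
  let L : Ω[B⁄k] →ₗ[B] B := (LinearMap.liftBaseChange B l) ∘ₗ e.symm.toLinearMap
  refine ⟨L.compDer (KaehlerDifferential.D k B), fun a => ?_⟩
  change LinearMap.liftBaseChange B l (e.symm (KaehlerDifferential.D k B (algebraMap A B a))) = _
  rw [KaehlerDifferential.tensorKaehlerEquivOfFormallyEtale_symm_D_algebraMap]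
  simp [l]; rfl

end Maps
end Algebra

noncomputable section Schemes

variable {k : Type u} [Field k] {X Y : Scheme.{u}}

/-- The structure homomorphism `k → Γ(X, U)` of a `k`-scheme `f : X ⟶ Spec k`. -/
def toSec (f : X ⟶ Spec (.of k)) (U : X.Opens) : CommRingCat.of k ⟶ Γ(X, U) :=
  (Scheme.ΓSpecIso (.of k)).inv ≫ f.appTop ≫ X.presheaf.map (homOfLE le_top).op

/-- The ring `Γ(X, U)`, regarded as a `k`-algebra through `f : X ⟶ Spec k`. -/
def Sec (_f : X ⟶ Spec (.of k)) (U : X.Opens) : Type u := Γ(X, U)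

instance (f : X ⟶ Spec (.of k)) (U : X.Opens) : CommRing (Sec f U) :=
  inferInstanceAs (CommRing Γ(X, U))

instance (f : X ⟶ Spec (.of k)) (U : X.Opens) : Algebra k (Sec f U) :=
  RingHom.toAlgebra (R := k) (S := Γ(X, U)) (toSec f U).hom

/-- The local ring `𝒪_{X, x}`, regarded as a `k`-algebra through `f : X ⟶ Spec k`. -/
def Stalk (_f : X ⟶ Spec (.of k)) (x : X) : Type u := X.presheaf.stalk x

instance (f : X ⟶ Spec (.of k)) (x : X) : CommRing (Stalk f x) :=
  inferInstanceAs (CommRing (X.presheaf.stalk x))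

instance (f : X ⟶ Spec (.of k)) (x : X) : Algebra k (Stalk f x) :=
  RingHom.toAlgebra (R := k) (S := X.presheaf.stalk x)
    (toSec f ⊤ ≫ X.presheaf.germ ⊤ x (Opens.mem_top _)).hom

lemma toSec_map (f : X ⟶ Spec (.of k)) {U V : X.Opens} (h : V ≤ U) :
    toSec f U ≫ X.presheaf.map (homOfLE h).op = toSec f V := by
  simp only [toSec, Category.assoc, ← Functor.map_comp]; rfl

lemma toSec_germ (f : X ⟶ Spec (.of k)) (U : X.Opens) (x : X) (h : x ∈ U) :
    toSec f U ≫ X.presheaf.germ U x h = toSec f ⊤ ≫ X.presheaf.germ ⊤ x (Opens.mem_top _) := by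
  rw [← toSec_map f (le_top : U ≤ ⊤), Category.assoc, X.presheaf.germ_res]

lemma toSec_app (f : X ⟶ Spec (.of k)) (i : Y ⟶ X) (U : X.Opens) :
    toSec f U ≫ i.app U = toSec (i ≫ f) (i ⁻¹ᵁ U) := by
  simp only [toSec, Category.assoc, Scheme.Hom.naturality, Scheme.Hom.comp_appTop]; rfl

variable (f : X ⟶ Spec (.of k))

/-- Restriction of functions. -/
def res {U V : X.Opens} (h : V ≤ U) : Sec f U →ₐ[k] Sec f V where
  __ := (X.presheaf.map (homOfLE h).op).hom
  commutes' r := congr($(toSec_map f h).hom r)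

/-- The germ of a function at a point. -/
def germ (U : X.Opens) (x : X) (h : x ∈ U) : Sec f U →ₐ[k] Stalk f x where
  __ := (X.presheaf.germ U x h).hom
  commutes' r := congr($(toSec_germ f U x h).hom r)

/-- Pullback of functions along `i : Y ⟶ X`. -/
def pull (i : Y ⟶ X) (U : X.Opens) : Sec f U →ₐ[k] Sec (i ≫ f) (i ⁻¹ᵁ U) where
  __ := (i.app U).hom
  commutes' r := congr($(toSec_app f i U).hom r)

/-- Pullback of germs of functions along `i : Y ⟶ X`. -/
def pullGerm (i : Y ⟶ X) (y : Y) : Stalk f (i y) →ₐ[k] Stalk (i ≫ f) y where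
  __ := (i.stalkMap y).hom
  commutes' r := by
    have : (toSec f ⊤ ≫ X.presheaf.germ ⊤ (i y) (Opens.mem_top _)) ≫ i.stalkMap y =
        toSec (i ≫ f) ⊤ ≫ Y.presheaf.germ ⊤ y (Opens.mem_top _) := by
      rw [Category.assoc, Scheme.Hom.germ_stalkMap, ← Category.assoc, toSec_app]; rfl
    exact congr($(this).hom r)

lemma res_germ {U V : X.Opens} (h : V ≤ U) (x : X) (hx : x ∈ V) (a : Sec f U) :
    germ f V x hx (res f h a) = germ f U x (h hx) a :=
  X.presheaf.germ_res_apply (homOfLE h) x hx a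

lemma res_res {U V W : X.Opens} (h : V ≤ U) (h' : W ≤ V) (a : Sec f U) :
    res f h' (res f h a) = res f (h'.trans h) a := by
  change (X.presheaf.map (homOfLE h).op ≫ X.presheaf.map (homOfLE h').op).hom a = _
  rw [← Functor.map_comp]; rfl

lemma pullGerm_germ (i : Y ⟶ X) (U : X.Opens) (y : Y) (h : i y ∈ U) (a : Sec f U) :
    pullGerm f i y (germ f U (i y) h a) = germ (i ≫ f) (i ⁻¹ᵁ U) y h (pull f i U a) :=
  Scheme.Hom.germ_stalkMap_apply i U y h a

lemma sec_ext (U : X.Opens) (a b : Sec f U)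
    (h : ∀ x (hx : x ∈ U), germ f U x hx a = germ f U x hx b) : a = b :=
  TopCat.Presheaf.section_ext X.sheaf U a b h

lemma formallyEtale_res {U V : X.Opens} (hU : IsAffineOpen U) (hV : IsAffineOpen V) (h : V ≤ U) :
    (res f h).toRingHom.FormallyEtale := by
  have h1 := Scheme.Hom.etale_appLE (𝟙 X) hU hV h
  have h2 : (Scheme.Hom.appLE (𝟙 X) U V h) = X.presheaf.map (homOfLE h).op := by
    simp [Scheme.Hom.appLE]; exact Category.id_comp _
  rw [h2] at h1
  let := (res f h).toRingHom.toAlgebra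
  have : Algebra.Etale (Sec f U) (Sec f V) := h1
  exact this.formallyEtale

lemma formallyEtale_germ {U : X.Opens} (hU : IsAffineOpen U) (x : X) (h : x ∈ U) :
    (germ f U x h).toRingHom.FormallyEtale := by
  let := X.presheaf.algebra_section_stalk ⟨x, h⟩
  have := hU.isLocalization_stalk ⟨x, h⟩
  have := Algebra.FormallyEtale.of_isLocalization (Rₘ := X.presheaf.stalk x)
    (hU.primeIdealOf ⟨x, h⟩).asIdeal.primeCompl
  exact this

/-- A `2`-form on the `k`-scheme `X`, i.e. a global section of `Ω²_{X/k}`: a compatible family of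
`2`-forms on the affine opens. -/
structure TwoForm where
  val : ∀ U : X.affineOpens, ⋀[Sec f U]^2 Ω[Sec f U⁄k]
  val_res : ∀ (U V : X.affineOpens) (h : V.1 ≤ U.1), mapTwo (res f h) (val U) = val V

/-- Vector fields on an open `U`. -/
abbrev VectorField (U : X.Opens) : Type u := Derivation k (Sec f U) (Sec f U)

variable {f}

/-- The value `ω(D, E)` of a `2`-form on two vector fields. -/
def TwoForm.eval (ω : TwoForm f) (U : X.affineOpens) (D E : VectorField f U) : Sec f U :=
  contractOne E (contractTwo D (ω.val U))

/-- A symplectic form: closed (`dω(D, E, F) = 0` for all vector fields) and nondegenerate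
(`D ↦ i_D ω` is an isomorphism from vector fields to `1`-forms). -/
structure TwoForm.IsSymplectic (ω : TwoForm f) : Prop where
  closed : ∀ (U : X.affineOpens) (D E F : VectorField f U),
    D (ω.eval U E F) - E (ω.eval U D F) + F (ω.eval U D E)
      - ω.eval U ⁅D, E⁆ F + ω.eval U ⁅D, F⁆ E - ω.eval U ⁅E, F⁆ D = 0
  nondegenerate : ∀ U : X.affineOpens,
    Function.Bijective fun D : VectorField f U => contractTwo D (ω.val U)

/-- The Hamiltonian vector field `H_a` of a function `a`, normalised by `i_{H_a} ω = -da`. -/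
def hamiltonian {ω : TwoForm f} (hω : ω.IsSymplectic) (U : X.affineOpens) (a : Sec f U) :
    VectorField f U :=
  ((hω.nondegenerate U).2 (-KaehlerDifferential.D k (Sec f U) a)).choose

lemma hamiltonian_spec {ω : TwoForm f} (hω : ω.IsSymplectic) (U : X.affineOpens) (a : Sec f U) :
    contractTwo (hamiltonian hω U a) (ω.val U) = -KaehlerDifferential.D k (Sec f U) a :=
  ((hω.nondegenerate U).2 (-KaehlerDifferential.D k (Sec f U) a)).choose_spec

/-- The Poisson bracket `{a, b} = H_a(b) = ω(H_a, H_b)`. -/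
def poissonBracket {ω : TwoForm f} (hω : ω.IsSymplectic) (U : X.affineOpens) (a b : Sec f U) :
    Sec f U :=
  hamiltonian hω U a b

lemma hamiltonian_res {ω : TwoForm f} (hω : ω.IsSymplectic) (U V : X.affineOpens)
    (h : V.1 ≤ U.1) (a b : Sec f U) :
    hamiltonian hω V (res f h a) (res f h b) = res f h (hamiltonian hω U a b) := by
  obtain ⟨E, hE⟩ := exists_extend (res f h) (formallyEtale_res f U.2 V.2 h) (hamiltonian hω U a)
  have : E = hamiltonian hω V (res f h a) := by
    apply (hω.nondegenerate V).1
    change contractTwo E (ω.val V) = contractTwo _ (ω.val V)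
    rw [hamiltonian_spec, ← ω.val_res U V h, contractTwo_mapTwo (res f h) _ E hE,
      hamiltonian_spec, map_neg, mapOne_D]
  rw [← this, hE]

variable (f)

/-- The exact `1`-forms `d𝒪_{X,x}` in the stalk `Ω¹_{X,x}`. -/
def exactGerms (x : X) : Submodule k Ω[Stalk f x⁄k] :=
  LinearMap.range (KaehlerDifferential.D k (Stalk f x)).toLinearMap

/-- The stalk at `x` of the sheaf `Ω¹_X / d𝒪_X`. -/
abbrev QuotGerm (x : X) : Type u := Ω[Stalk f x⁄k] ⧸ exactGerms f x

/-- The class in `Ω¹_{X,x} / d𝒪_{X,x}` of a `1`-form `α` on an open neighbourhood `U` of `x`. -/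
def germClass (U : X.Opens) (x : X) (h : x ∈ U) : Ω[Sec f U⁄k] →ₗ[k] QuotGerm f x :=
  (exactGerms f x).mkQ ∘ₗ mapOne (germ f U x h)

/-- The `1`-form `α` on `U` represents the family of germs `s` on `U`. -/
def Represents (s : ∀ x, QuotGerm f x) (U : X.Opens) (α : Ω[Sec f U⁄k]) : Prop :=
  ∀ x (h : x ∈ U), s x = germClass f U x h α

lemma germClass_res {U V : X.Opens} (h : V ≤ U) (x : X) (hx : x ∈ V) (α : Ω[Sec f U⁄k]) :
    germClass f V x hx (mapOne (res f h) α) = germClass f U x (h hx) α := by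
  simp only [germClass, LinearMap.comp_apply]
  rw [mapOne_comp _ _ _ (fun a => res_germ f h x hx a)]

lemma Represents.res {s : ∀ x, QuotGerm f x} {U V : X.Opens} (h : V ≤ U) {α : Ω[Sec f U⁄k]}
    (hα : Represents f s U α) : Represents f s V (mapOne (res f h) α) := fun x hx => by
  rw [germClass_res]; exact hα x (h hx)

lemma exists_affine_le {U : X.Opens} {x : X} (h : x ∈ U) :
    ∃ V : X.affineOpens, x ∈ V.1 ∧ V.1 ≤ U := by
  obtain ⟨V, hV, hx, hVU⟩ :=
    (Opens.isBasis_iff_nbhd.mp X.isBasis_affineOpens) h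
  exact ⟨⟨V, hV⟩, hx, hVU⟩

/-- The group `H¹(X, Ω^{≤1})` of classes `[η]`, where `Ω^{≤1}` is the truncation of the de Rham
complex concentrated in degree `1`, with term the sheaf `Ω¹_X / d𝒪_X`: the global sections of
`Ω¹_X / d𝒪_X`, that is, families of germs that are Zariski locally represented by `1`-forms.
A class vanishes if and only if its representatives are locally exact. -/
def TruncH1 : Submodule k (∀ x, QuotGerm f x) where
  carrier := {s | ∀ x, ∃ U : X.affineOpens, x ∈ U.1 ∧ ∃ α, Represents f s U α}
  zero_mem' x := by
    obtain ⟨U, hU, -⟩ := exists_affine_le (Opens.mem_top x)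
    exact ⟨U, hU, 0, fun y hy => by simp⟩
  add_mem' {s t} hs ht x := by
    obtain ⟨U, hU, α, hα⟩ := hs x
    obtain ⟨V, hV, β, hβ⟩ := ht x
    obtain ⟨W, hW, hWUV⟩ := exists_affine_le (U := U.1 ⊓ V.1) ⟨hU, hV⟩
    refine ⟨W, hW, mapOne (res f (hWUV.trans inf_le_left)) α +
      mapOne (res f (hWUV.trans inf_le_right)) β, fun y hy => ?_⟩
    rw [map_add, Pi.add_apply, ← hα.res f (hWUV.trans inf_le_left) y hy,
      ← hβ.res f (hWUV.trans inf_le_right) y hy]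
  smul_mem' c s hs x := by
    obtain ⟨U, hU, α, hα⟩ := hs x
    exact ⟨U, hU, c • α, fun y hy => by rw [map_smul, Pi.smul_apply, hα y hy]⟩

lemma exactGerms_le (i : Y ⟶ X) (y : Y) : exactGerms f (i y) ≤
    (exactGerms (i ≫ f) y).comap (mapOne (pullGerm f i y)) := by
  rintro _ ⟨a, rfl⟩
  exact ⟨pullGerm f i y a, (mapOne_D _ _).symm⟩

/-- Pullback of classes: `[η] ↦ [η]_Y` for `i : Y ⟶ X`. -/
def TruncH1.pullback (i : Y ⟶ X) : TruncH1 f →ₗ[k] TruncH1 (i ≫ f) where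
  toFun s := ⟨fun y => Submodule.mapQ _ _ (mapOne (pullGerm f i y)) (exactGerms_le f i y)
      (s.1 (i y)), fun y => by
    obtain ⟨U, hU, α, hα⟩ := s.2 (i y)
    obtain ⟨V, hV, hVU⟩ := exists_affine_le (U := i ⁻¹ᵁ U.1) (x := y) hU
    refine ⟨V, hV, mapOne (res (i ≫ f) hVU) (mapOne (pull f i U) α), fun z hz => ?_⟩
    rw [germClass_res]
    refine (congrArg (Submodule.mapQ _ _ (mapOne (pullGerm f i z)) (exactGerms_le f i z))
      (hα (i z) (hVU hz))).trans ?_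
    change (exactGerms (i ≫ f) z).mkQ (mapOne (pullGerm f i z) (mapOne (germ f U (i z) _) α)) =
      (exactGerms (i ≫ f) z).mkQ (mapOne (germ (i ≫ f) _ z _) (mapOne (pull f i U) α))
    rw [mapOne_comp (pull f i U) _ ((pullGerm f i z).comp (germ f U (i z) (hVU hz)))
      (fun a => (pullGerm_germ f i U z (hVU hz) a).symm),
      mapOne_comp _ _ ((pullGerm f i z).comp (germ f U (i z) (hVU hz))) (fun _ => rfl)]⟩
  map_add' s t := by ext y; simp
  map_smul' c s := by ext y; simp

variable {f}

/-- `d[η] = ω`: every `1`-form `α` locally representing `[η]` satisfies `dα = ω`. -/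
def IsPotential (η : TruncH1 f) (ω : TwoForm f) : Prop :=
  ∀ (U : X.affineOpens) (α : Ω[Sec f U⁄k]), Represents f η.1 U α → dOne α = ω.val U

section RestrictedOperation

variable (p : ℕ) [Fact p.Prime] [CharP k p]

lemma germ_contraction_eq {ω : TwoForm f} (hω : ω.IsSymplectic) (s : ∀ x, QuotGerm f x)
    {U : X.Opens} (a : Sec f U) (V V' : X.affineOpens) (hV : V.1 ≤ U) (hV' : V'.1 ≤ U)
    (α : Ω[Sec f V⁄k]) (α' : Ω[Sec f V'⁄k]) (hα : Represents f s V α)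
    (hα' : Represents f s V' α') (x : X) (hx : x ∈ V.1) (hx' : x ∈ V'.1) :
    germ f V x hx (restrictedContraction p (hamiltonian hω V (res f hV a)) α) =
      germ f V' x hx' (restrictedContraction p (hamiltonian hω V' (res f hV' a)) α') := by
  obtain ⟨W, hW, hWV⟩ := exists_affine_le (U := V.1 ⊓ V'.1) ⟨hx, hx'⟩
  have h1 := hWV.trans inf_le_left
  have h2 := hWV.trans inf_le_right
  rw [← res_germ f h1 x hW, ← res_germ f h2 x hW,
    ← restrictedContraction_mapOne p (res f h1) _ _ (hamiltonian_res hω V W h1 _),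
    ← restrictedContraction_mapOne p (res f h2) _ _ (hamiltonian_res hω V' W h2 _),
    res_res, res_res]
  obtain ⟨E, hE⟩ := exists_extend (germ f W x hW) (formallyEtale_germ f W.2 x hW)
    (hamiltonian hω W (res f (h1.trans hV) a))
  rw [← restrictedContraction_mapOne p _ _ E hE, ← restrictedContraction_mapOne p _ _ E hE]
  have h3 := (hα.res f h1 x hW).symm.trans (hα'.res f h2 x hW)
  obtain ⟨g, hg⟩ := (Submodule.Quotient.eq _).mp h3
  rw [← sub_add_cancel (mapOne (germ f W x hW) (mapOne (res f h1) α))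
    (mapOne (germ f W x hW) (mapOne (res f h2) α')), ← hg, add_comm]
  exact restrictedContraction_add_D p _ _ g

lemma existsUnique_restrictedPower {ω : TwoForm f} (hω : ω.IsSymplectic) (η : TruncH1 f)
    (U : X.Opens) (a : Sec f U) :
    ∃! b : Sec f U, ∀ (V : X.affineOpens) (h : V.1 ≤ U) (α : Ω[Sec f V⁄k]),
      Represents f η.1 V α →
        res f h b = restrictedContraction p (hamiltonian hω V (res f h a)) α := by
  let ι := {q : Σ V : X.affineOpens, Ω[Sec f V⁄k] // q.1.1 ≤ U ∧ Represents f η.1 q.1 q.2}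
  let c : ∀ q : ι, Sec f q.1.1 := fun q =>
    restrictedContraction p (hamiltonian hω q.1.1 (res f q.2.1 a)) q.1.2
  have hcover : U ≤ iSup fun q : ι => q.1.1.1 := fun x hx => by
    obtain ⟨V, hV, α, hα⟩ := η.2 x
    obtain ⟨W, hW, hWV⟩ := exists_affine_le (U := U ⊓ V.1) ⟨hx, hV⟩
    exact Opens.mem_iSup.mpr ⟨⟨⟨W, mapOne (res f (hWV.trans inf_le_right)) α⟩,
      hWV.trans inf_le_left, hα.res f _⟩, hW⟩
  obtain ⟨b, hb, hb'⟩ := X.sheaf.existsUnique_gluing' (fun q : ι => q.1.1.1) U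
    (fun q => homOfLE q.2.1) hcover c (fun q r => by
      refine sec_ext f (q.1.1.1 ⊓ r.1.1.1) _ _ fun x hx => ?_
      refine (res_germ f inf_le_left x hx (c q)).trans
        (Eq.trans ?_ (res_germ f inf_le_right x hx (c r)).symm)
      exact germ_contraction_eq p hω η.1 a _ _ _ _ _ _ q.2.2 r.2.2 x _ _)
  refine ⟨b, fun V h α hα => hb ⟨⟨V, α⟩, h, hα⟩, fun b' h' => hb' b' fun q => ?_⟩
  exact h' q.1.1 q.2.1 q.1.2 q.2.2

/-- The restricted operation `a ↦ a^[p]` on `𝒪_X` determined by `[η]`: the function with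
`a^[p] = i^[p]_{H_a} α` on each affine open on which `[η]` is represented by a `1`-form `α`. -/
def restrictedPower {ω : TwoForm f} (hω : ω.IsSymplectic) (η : TruncH1 f) (U : X.Opens)
    (a : Sec f U) : Sec f U :=
  (existsUnique_restrictedPower p hω η U a).choose

end RestrictedOperation

/-- The sections over `U` of the ideal sheaf of `i : Y ⟶ X`. -/
def idealOf (f : X ⟶ Spec (.of k)) (i : Y ⟶ X) (U : X.Opens) : Ideal (Sec f U) :=
  RingHom.ker (pull f i U)

/-- A closed subscheme `i : Y ⟶ X` is Lagrangian if it is isotropic (`ω|_Y = 0`) and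
coisotropic (its ideal sheaf is closed under the Poisson bracket). -/
structure IsLagrangian {ω : TwoForm f} (hω : ω.IsSymplectic) (i : Y ⟶ X) : Prop where
  isotropic : ∀ U : X.affineOpens, mapTwo (pull f i U) (ω.val U) = 0
  coisotropic : ∀ (U : X.affineOpens) (a b : Sec f U), a ∈ idealOf f i U → b ∈ idealOf f i U →
    poissonBracket hω U a b ∈ idealOf f i U

end Schemes
end RestrictedSymplectic

open RestrictedSymplectic

/-!
Let `I` be the ideal of `Y`, let `α` represent `[η]` on an affine open `U`, and let `β` be the
restriction of `α` to `Y`. It is closed, since `dα = ω` and `Y` is isotropic.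

For `a ∈ I` the Hamiltonian field `H_a` preserves `I`, hence restricts to a vector field `E` on `Y`,
and the restriction of `a^[p]` to `Y` is the restricted contraction `i^[p]_E β`. An exact form `dg`
has `i^[p]_E dg = E^p g - E^(p-1) (E g) = 0`, so `I` is stable under the restricted operation if `β`
is locally exact (`restrictedPower_mem_of_pullback_eq_zero`).

Conversely, every vector field `E` on `Y ∩ U` arises from some `a ∈ I`
(`exists_hamiltonian_lift`): lift `E` to a vector field `D` on `U`; the `1`-form `i_D ω` restricts to
zero on `Y`, so by the conormal sequence it agrees with some `db`, `b ∈ I`, modulo `I Ω¹`, and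
nondegeneracy of `ω` shows that `D` and `H_{-b}` agree on `Y`. Hence, if `I` is stable, then
`i^[p]_E β = 0` for all vector fields `E` on `Y ∩ U`. In the local ring of `Y` at a point, choose
functions `xᵢ` whose differentials are a basis of the `1`-forms, and let `∂ᵢ` be the dual vector
fields. They commute and have `∂ᵢ^p = 0`, and `u ∂ᵢ` is defined on `Y ∩ U` for a denominator `u`
which may be taken to be a `p`-th power, hence a constant for `∂ᵢ`. So `∂ᵢ^(p-1) βᵢ = 0` for the
coefficients `βᵢ` of `β` (`exists_D_eq_mapOne_of_isLocalization`). This is the vanishing of the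
Cartier operator on `β`, written in coordinates, and it is what is needed to integrate the closed
form `β` one coordinate at a time by the explicit primitive
`∑ (-1)^m x^(m+1) ∂^m h / (m+1)!` of a function `h` with `∂^(p-1) h = 0`
(`exists_primitive`, `exists_D_eq_of_restrictedContraction_eq_zero`).
-/

namespace RestrictedSymplectic

/-! ### Contractions and exterior derivatives -/

section Forms

variable {k A B : Type*} [Field k] [CommRing A] [Algebra k A] [CommRing B] [Algebra k B]

lemma one_forms_induction {P : Ω[A⁄k] → Prop} (h0 : P 0)
    (hadd : ∀ x y, P x → P y → P (x + y))
    (hD : ∀ a b : A, P (a • KaehlerDifferential.D k A b)) (α : Ω[A⁄k]) : P α := by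
  have hα : α ∈ Submodule.span A (Set.range (KaehlerDifferential.D k A)) := by
    rw [KaehlerDifferential.span_range_derivation]; trivial
  induction hα using Submodule.closure_induction with
  | zero => exact h0
  | add x y _ _ hx hy => exact hadd x y hx hy
  | smul_mem a x hx => obtain ⟨b, rfl⟩ := hx; exact hD a b

lemma mapTwo_dOne (φ : A →ₐ[k] B) (α : Ω[A⁄k]) : mapTwo φ (dOne α) = dOne (mapOne φ α) := by
  induction α using one_forms_induction with
  | h0 => simp
  | hadd x y hx hy => simp only [map_add, hx, hy]
  | hD a b =>
    rw [dOne_smul_D, mapTwo_wedge, mapOne_smul, mapOne_D, mapOne_D, dOne_smul_D]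

lemma dOne_D (a : A) : dOne (KaehlerDifferential.D k A a) = 0 := by
  simpa [wedge_zero_left] using dOne_smul_D (k := k) (1 : A) a

lemma contractOne_smul_left (c : A) (D : Derivation k A A) (α : Ω[A⁄k]) :
    contractOne (c • D) α = c * contractOne D α := by
  induction α using one_forms_induction with
  | h0 => simp
  | hadd x y hx hy => simp only [map_add, hx, hy, mul_add]
  | hD a b => simp [mul_left_comm]

/-- Interior multiplication `D ↦ i_D w` by a fixed `2`-form is linear in the vector field. -/
noncomputable def contractTwoHom (w : ⋀[A]^2 Ω[A⁄k]) : Derivation k A A →ₗ[A] Ω[A⁄k] where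
  toFun D := contractTwo D w
  map_add' D E := by
    have h : ∀ γ, contractOne (D + E) γ = contractOne D γ + contractOne E γ := fun γ => by
      induction γ using one_forms_induction with
      | h0 => simp
      | hadd x y hx hy => simp only [map_add, hx, hy]; abel
      | hD a b => simp [mul_add]
    induction w using two_forms_induction with
    | h0 => simp
    | hadd x y hx hy => simp only [map_add, hx, hy]; abel
    | hsmul a x hx => simp only [map_smul, hx, smul_add]
    | hw α β => simp only [contractTwo_wedge, h, add_smul]; abel
  map_smul' c D := by
    induction w using two_forms_induction with
    | h0 => simp
    | hadd x y hx hy => simp only [map_add, hx, hy, smul_add]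
    | hsmul a x hx => rw [map_smul, hx, map_smul, RingHom.id_apply, smul_comm]
    | hw α β =>
      simp only [contractTwo_wedge, contractOne_smul_left, mul_smul, smul_sub, RingHom.id_apply]

/-- For a closed `1`-form `α` and commuting vector fields, both `dα` and the bracket term drop out
of Cartan's formula `dα(D, E) = D(i_E α) - E(i_D α) - i_[D,E] α`. -/
lemma derivation_contractOne_comm (D E : Derivation k A A) (hDE : ∀ a, D (E a) = E (D a))
    (α : Ω[A⁄k]) (hα : dOne α = 0) :
    D (contractOne E α) = E (contractOne D α) := by
  have key : ∀ α : Ω[A⁄k], contractOne E (contractTwo D (dOne α)) =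
      D (contractOne E α) - E (contractOne D α) := fun α => by
    induction α using one_forms_induction with
    | h0 => simp
    | hadd x y hx hy => simp only [map_add, hx, hy]; abel
    | hD a b =>
      rw [dOne_smul_D, contractTwo_wedge]
      simp [hDE]; ring
  rw [← sub_eq_zero, ← key, hα, map_zero, map_zero]

end Forms

/-! ### Vector fields on an isotropic closed subscheme -/

section Lifting

variable {k A B : Type*} [Field k] [CommRing A] [Algebra k A] [CommRing B] [Algebra k B]

/-- Exactness of the conormal sequence `I / I² → Ω¹_A ⊗ B → Ω¹_B → 0` for `B = A / I`: a `1`-form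
`γ` with zero pullback to `B` agrees with `da`, for some `a ∈ I`, in `Ω¹_A ⊗ B`. The latter is
expressed by testing against all semilinear maps from `Ω¹_A` to `B`. -/
lemma exists_D_eq_of_mapOne_eq_zero (φ : A →ₐ[k] B) (hφ : Function.Surjective φ)
    (γ : Ω[A⁄k]) (hγ : mapOne φ γ = 0) :
    ∃ a ∈ RingHom.ker φ, ∀ l : Ω[A⁄k] →ₛₗ[φ.toRingHom] B,
      l γ = l (KaehlerDifferential.D k A a) := by
  let := φ.toRingHom.toAlgebra
  have : IsScalarTower k A B := IsScalarTower.of_algebraMap_eq fun r => (φ.commutes r).symm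
  have hmem : KaehlerDifferential.mapBaseChange k A B (1 ⊗ₜ γ) = 0 := by
    rw [KaehlerDifferential.mapBaseChange_tmul, one_smul]; exact hγ
  obtain ⟨t, ht⟩ :=
    (KaehlerDifferential.exact_kerCotangentToTensor_mapBaseChange k A B hφ _).mp hmem
  obtain ⟨⟨a, ha⟩, rfl⟩ := Ideal.toCotangent_surjective _ t
  rw [KaehlerDifferential.kerCotangentToTensor_toCotangent] at ht
  refine ⟨a, ha, fun l => ?_⟩
  let l' : Ω[A⁄k] →ₗ[A] B :=
    { toFun := l
      map_add' := map_add l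
      map_smul' := fun c x => by
        rw [LinearMap.map_smulₛₗ, RingHom.id_apply, Algebra.smul_def]; rfl }
  have := congr(LinearMap.liftBaseChange B l' $ht)
  simp only [LinearMap.liftBaseChange_tmul, one_smul] at this
  exact this.symm

/-- Vector fields on a closed subscheme of a smooth affine scheme extend to the ambient scheme. -/
lemma exists_derivation_lift [Algebra.FormallySmooth k A] (φ : A →ₐ[k] B)
    (hφ : Function.Surjective φ) (E : Derivation k B B) :
    ∃ D : Derivation k A A, ∀ a, E (φ a) = φ (D a) := by
  let := φ.toRingHom.toAlgebra
  have : IsScalarTower k A B := IsScalarTower.of_algebraMap_eq fun r => (φ.commutes r).symm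
  obtain ⟨l, hl⟩ := Module.projective_lifting_property (Algebra.linearMap A B)
    ((contractOne E).restrictScalars A ∘ₗ KaehlerDifferential.map k k A B) hφ
  refine ⟨l.compDer (KaehlerDifferential.D k A), fun a => ?_⟩
  have := congr($hl (KaehlerDifferential.D k A a))
  simp at this
  exact this.symm

/-- Every vector field on an isotropic closed subscheme of a smooth affine symplectic scheme is
the restriction of the Hamiltonian vector field of a function in the ideal. -/
lemma exists_hamiltonian_lift [Algebra.FormallySmooth k A] (φ : A →ₐ[k] B)
    (hφ : Function.Surjective φ) (w : ⋀[A]^2 Ω[A⁄k])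
    (hw : Function.Bijective fun D : Derivation k A A => contractTwo D w)
    (hφw : mapTwo φ w = 0) (E : Derivation k B B) :
    ∃ a ∈ RingHom.ker φ, ∀ D : Derivation k A A,
      contractTwo D w = -KaehlerDifferential.D k A a → ∀ b, E (φ b) = φ (D b) := by
  obtain ⟨D₀, hD₀⟩ := exists_derivation_lift φ hφ E
  let e : Derivation k A A ≃ₗ[A] Ω[A⁄k] := LinearEquiv.ofBijective (contractTwoHom w) hw
  have hγ : mapOne φ (contractTwo D₀ w) = 0 := by
    rw [← contractTwo_mapTwo φ D₀ E hD₀, hφw, map_zero]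
  obtain ⟨a, ha, hl⟩ := exists_D_eq_of_mapOne_eq_zero φ hφ _ hγ
  refine ⟨-a, neg_mem ha, fun D hD b => ?_⟩
  -- Evaluating the vector field dual to `θ` under `w` at `b` and restricting is semilinear in `θ`.
  have h := hl
    { toFun := fun θ => φ (e.symm θ b)
      map_add' := fun x y => by simp
      map_smul' := fun c x => by simp }
  have h₀ : e.symm (contractTwo D₀ w) = D₀ := e.symm_apply_apply D₀
  have h₁ : e.symm (KaehlerDifferential.D k A a) = D := by
    rw [LinearEquiv.symm_apply_eq]
    have h : e D = - KaehlerDifferential.D k A (-a) := hD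
    rw [h, map_neg, neg_neg]
  change φ (e.symm (contractTwo D₀ w) b) = φ (e.symm (KaehlerDifferential.D k A a) b) at h
  rw [hD₀, ← h₁, ← h, h₀]

end Lifting

/-! ### The Poincaré lemma in characteristic `p` -/

section Integration

variable {k A : Type*} [Field k] [CommRing A] [Algebra k A] (p : ℕ) [Fact p.Prime] [CharP k p]

lemma restrictedContraction_D (D : Derivation k A A) (g : A) :
    restrictedContraction p D (KaehlerDifferential.D k A g) = 0 := by
  have := restrictedContraction_add_D p D 0 g
  rw [zero_add] at this
  rw [this, restrictedContraction, map_zero, map_zero, iterate_map_zero, sub_zero]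

/-- Integration with respect to a coordinate `x` with `D x = 1`: a function without terms of
degree `-1` modulo `p` in `x`, that is, with `D^(p-1) h = 0`, has the primitive
`∑ (-1)^m x^(m+1) D^m h / (m+1)!`, summed over `m < p - 1`. This primitive is killed by every
vector field commuting with `D` that kills `x` and `h`. -/
lemma exists_primitive (D : Derivation k A A) (x : A) (hx : D x = 1) (h : A)
    (hh : D^[p - 1] h = 0) :
    ∃ g, D g = h ∧ ∀ E : Derivation k A A, (∀ a, E (D a) = D (E a)) → E x = 0 → E h = 0 →
      E g = 0 := by
  have hp : p.Prime := Fact.out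
  let c : ℕ → k := fun m => (-1) ^ m * ((m + 1).factorial : k)⁻¹
  let S : ℕ → A := fun n => ∑ m ∈ Finset.range n, c m • (x ^ (m + 1) * D^[m] h)
  -- The derivative of the sum telescopes, up to a boundary term which vanishes for `n = p - 1`.
  have hS : ∀ n < p, D (S n) = h - ((-1) ^ n * (n.factorial : k)⁻¹) • (x ^ n * D^[n] h) := by
    intro n
    induction n with
    | zero => intro _; simp [S]
    | succ n ih =>
      intro hn
      have h0 : ((n + 1 : ℕ) : k) ≠ 0 := fun h0 =>
        Nat.not_dvd_of_pos_of_lt n.succ_pos hn ((CharP.cast_eq_zero_iff k p _).mp h0)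
      have h1 : (n.factorial : k) ≠ 0 := fun h0 =>
        absurd ((hp.dvd_factorial).mp ((CharP.cast_eq_zero_iff k p _).mp h0)) (by omega)
      have hc : c n * ((n + 1 : ℕ) : k) = (-1) ^ n * (n.factorial : k)⁻¹ := by
        simp only [c, Nat.factorial_succ, Nat.cast_mul]
        field_simp
      have hD : D (x ^ (n + 1) * D^[n] h) =
          ((n + 1 : ℕ) : k) • (x ^ n * D^[n] h) + x ^ (n + 1) * D^[n + 1] h := by
        rw [Derivation.leibniz, Derivation.leibniz_pow, hx, Nat.cast_smul_eq_nsmul]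
        simp only [Function.iterate_succ_apply', smul_eq_mul, nsmul_eq_mul, Nat.add_sub_cancel,
          mul_one]
        ring
      have hSn : S (n + 1) = S n + c n • (x ^ (n + 1) * D^[n] h) := Finset.sum_range_succ _ _
      rw [hSn, map_add, ih (by omega), Derivation.map_smul, hD, smul_add, smul_smul, hc]
      have hc' : (-1) ^ (n + 1) * (((n + 1).factorial : ℕ) : k)⁻¹ = - c n := by
        simp only [c, pow_succ]; ring
      rw [hc', neg_smul]; abel
  refine ⟨S (p - 1), by rw [hS _ (by have := hp.pos; omega), hh]; simp, fun E hE hEx hEh => ?_⟩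
  have hit : ∀ m, E (D^[m] h) = 0 := fun m => by
    induction m with
    | zero => exact hEh
    | succ m ih => rw [Function.iterate_succ_apply', hE, ih, map_zero]
  simp [S, hit, Derivation.leibniz_pow, hEx]

variable {κ : Type*} (b : Module.Basis κ A Ω[A⁄k])

/-- The coordinate vector field `∂ᵢ` dual to the `i`-th member of a basis `b` of the `1`-forms,
`∂ᵢ a = bᵢ^*(da)`. -/
noncomputable def coordField (i : κ) : Derivation k A A :=
  (b.coord i).compDer (KaehlerDifferential.D k A)

lemma contractOne_coordField (i : κ) (α : Ω[A⁄k]) : contractOne (coordField b i) α = b.repr α i := by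
  induction α using one_forms_induction with
  | h0 => simp
  | hadd y z hy hz => simp only [map_add, hy, hz, Finsupp.add_apply]
  | hD a c => simp [coordField]

variable (x : κ → A) (hb : ∀ i, b i = KaehlerDifferential.D k A (x i))
include hb

lemma coordField_apply [DecidableEq κ] (i j : κ) :
    coordField b i (x j) = if j = i then 1 else 0 := by
  simp [coordField, ← hb, Finsupp.single_apply]

lemma derivation_eq_zero_of_coord (D : Derivation k A A) (h : ∀ i, D (x i) = 0) : D = 0 := by
  have : contractOne D = 0 := b.ext fun i => by simp [hb, h]
  ext a
  simpa using congr($this (KaehlerDifferential.D k A a))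

lemma coordField_comm (i j : κ) (a : A) :
    coordField b i (coordField b j a) = coordField b j (coordField b i a) := by
  classical
  have : ⁅coordField b i, coordField b j⁆ = 0 := derivation_eq_zero_of_coord b x hb _ fun l => by
    rw [Derivation.commutator_apply, coordField_apply b x hb, coordField_apply b x hb]
    split_ifs <;> simp
  have := congr($this a)
  rwa [Derivation.commutator_apply, Derivation.zero_apply, sub_eq_zero] at this

lemma pthPower_coordField (i : κ) : pthPower p (coordField b i) = 0 := by
  classical
  refine derivation_eq_zero_of_coord b x hb _ fun l => ?_
  obtain ⟨n, hn⟩ := Nat.exists_eq_add_of_le' (Fact.out : p.Prime).two_le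
  rw [pthPower_apply, hn, Function.iterate_add_apply]
  have : (coordField b i)^[2] (x l) = 0 := by
    change coordField b i (coordField b i (x l)) = 0
    rw [coordField_apply b x hb]
    split_ifs <;> simp
  rw [this, iterate_map_zero]

/-- Poincaré lemma in characteristic `p`: in coordinates `xᵢ` whose differentials are a basis of
the `1`-forms, a closed `1`-form `∑ βᵢ dxᵢ` is exact if `i^[p]_{∂ᵢ} β = -∂ᵢ^(p-1) βᵢ` vanishes for
every `i`, i.e. if it is killed by the Cartier operator. The coordinates are integrated out one at
a time. -/
lemma exists_D_eq_of_restrictedContraction_eq_zero [Finite κ] (β : Ω[A⁄k]) (hβ : dOne β = 0)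
    (hβp : ∀ i, restrictedContraction p (coordField b i) β = 0) :
    ∃ g, KaehlerDifferential.D k A g = β := by
  classical
  have : Fintype κ := Fintype.ofFinite κ
  suffices H : ∀ s : Finset κ, ∃ g, ∀ i ∈ s, b.repr (β + KaehlerDifferential.D k A g) i = 0 by
    obtain ⟨g, hg⟩ := H Finset.univ
    refine ⟨-g, ?_⟩
    have : β + KaehlerDifferential.D k A g = 0 :=
      b.repr.map_eq_zero_iff.mp (Finsupp.ext fun i => hg i (Finset.mem_univ i))
    rw [map_neg, neg_eq_iff_add_eq_zero, add_comm, this]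
  intro s
  induction s using Finset.induction_on with
  | empty => exact ⟨0, by simp⟩
  | insert j s hj ih =>
    obtain ⟨g, hg⟩ := ih
    set γ := β + KaehlerDifferential.D k A g with hγ
    have hγd : dOne γ = 0 := by rw [hγ, map_add, hβ, dOne_D, add_zero]
    have hγp : (coordField b j)^[p - 1] (b.repr γ j) = 0 := by
      have h := hβp j
      rw [← restrictedContraction_add_D p _ β g, restrictedContraction,
        pthPower_coordField p b x hb, contractOne_coordField] at h
      have h0 : contractOne (0 : Derivation k A A) γ = 0 := by
        simpa using contractOne_smul_left (0 : A) 0 γ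
      rw [h0, zero_sub, neg_eq_zero] at h
      exact h
    obtain ⟨q, hq, hq'⟩ := exists_primitive p (coordField b j) (x j)
      (by simp [coordField_apply b x hb]) (b.repr γ j) hγp
    have hrepr : ∀ i, b.repr (KaehlerDifferential.D k A q) i = coordField b i q := fun _ => rfl
    refine ⟨g - q, fun i hi => ?_⟩
    have hsum : β + KaehlerDifferential.D k A (g - q) = γ - KaehlerDifferential.D k A q := by
      rw [hγ, map_sub]; abel
    rw [hsum, map_sub, Finsupp.sub_apply, hrepr]
    rcases Finset.mem_insert.mp hi with rfl | hi
    · rw [hq, sub_self]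
    -- The coefficients already removed stay zero: `∂ᵢ` kills the new primitive `q`, because
    -- closedness gives `∂ᵢ γⱼ = ∂ⱼ γᵢ = 0`.
    · rw [hg i hi, zero_sub, neg_eq_zero]
      refine hq' _ (coordField_comm b x hb i j) ?_ ?_
      · rw [coordField_apply b x hb, if_neg]
        rintro rfl; exact hj hi
      · have h := derivation_contractOne_comm _ _ (coordField_comm b x hb i j) γ hγd
        rw [contractOne_coordField, contractOne_coordField, hg i hi, map_zero] at h
        exact h

end Integration

/-! ### Local exactness on a smooth affine scheme -/

section Localization

/-- The restricted contraction is `p`-homogeneous with respect to functions constant along the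
vector field. -/
lemma restrictedContraction_smul_of_apply_eq_zero {k A : Type*} [Field k] [CommRing A]
    [Algebra k A] (p : ℕ) [Fact p.Prime] [CharP k p] (D : Derivation k A A) (c : A)
    (hc : D c = 0) (α : Ω[A⁄k]) :
    restrictedContraction p (c • D) α = c ^ p * restrictedContraction p D α := by
  have hit : ∀ (n : ℕ) (a : A), (c • D)^[n] a = c ^ n * D^[n] a := fun n a => by
    induction n with
    | zero => simp
    | succ n ih =>
      rw [Function.iterate_succ_apply', ih, Derivation.smul_apply, Derivation.leibniz,
        Derivation.leibniz_pow, hc, Function.iterate_succ_apply']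
      simp [pow_succ']; ring
  have hmul : ∀ (n : ℕ) (a : A), D^[n] (c * a) = c * D^[n] a := fun n a => by
    induction n with
    | zero => rfl
    | succ n ih =>
      rw [Function.iterate_succ_apply', ih, Derivation.leibniz, hc, Function.iterate_succ_apply']
      simp
  have hpow : pthPower p (c • D) = c ^ p • pthPower p D := by
    ext a
    rw [Derivation.smul_apply, pthPower_apply, pthPower_apply, hit, smul_eq_mul]
  rw [restrictedContraction, restrictedContraction, hpow, contractOne_smul_left,
    contractOne_smul_left, hit, hmul, mul_sub, ← mul_assoc, ← pow_succ,
    Nat.sub_add_cancel (Fact.out : p.Prime).pos]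

variable {k B R : Type u} [Field k] [CommRing B] [Algebra k B] [CommRing R] [Algebra k R]
  [Algebra B R] [IsScalarTower k B R]

/-- A vector field on a localization of `B` becomes a vector field on `B` after multiplication
by a denominator. -/
lemma exists_smul_derivation_of_isLocalization [Module.FinitePresentation B Ω[B⁄k]]
    (M : Submonoid B) [IsLocalization M R] (D : Derivation k R R) :
    ∃ s ∈ M, ∃ E : Derivation k B B,
      ∀ b, algebraMap B R (E b) = algebraMap B R s * D (algebraMap B R b) := by
  have : IsLocalizedModule M (Algebra.linearMap B R) := inferInstance
  obtain ⟨h, s, hs⟩ := Module.FinitePresentation.exists_lift_of_isLocalizedModule M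
    (Algebra.linearMap B R)
    ((contractOne D).restrictScalars B ∘ₗ KaehlerDifferential.map k k B R)
  refine ⟨s, s.2, h.compDer (KaehlerDifferential.D k B), fun b => ?_⟩
  have := congr($hs (KaehlerDifferential.D k B b))
  simp [Submonoid.smul_def, Algebra.smul_def] at this
  exact this

variable (p : ℕ) [Fact p.Prime] [CharP k p]

/-- A closed `1`-form on a smooth affine scheme whose restricted contraction with every vector
field vanishes becomes exact in every localization that is a local ring. -/
lemma exists_D_eq_mapOne_of_isLocalization [Algebra.Smooth k B] [IsLocalRing R]
    (M : Submonoid B) [IsLocalization M R] (β : Ω[B⁄k]) (hβ : dOne β = 0)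
    (hβp : ∀ E : Derivation k B B, restrictedContraction p E β = 0) :
    ∃ g, KaehlerDifferential.D k R g = mapOne (IsScalarTower.toAlgHom k B R) β := by
  have : Algebra.FormallySmooth B R := Algebra.FormallySmooth.of_isLocalization M
  have : Algebra.FormallySmooth k R := Algebra.FormallySmooth.comp k B R
  have : Algebra.EssFiniteType B R := Algebra.EssFiniteType.of_isLocalization R M
  have : Algebra.EssFiniteType k R := Algebra.EssFiniteType.comp k B R
  obtain ⟨κ, a, b, hb⟩ := Module.exists_basis_of_span_of_flat (R := R)
    (KaehlerDifferential.D k R) (KaehlerDifferential.span_range_derivation k R)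
  have : Finite κ := Module.Finite.finite_basis b
  refine exists_D_eq_of_restrictedContraction_eq_zero p b a hb _ ?_ fun i => ?_
  · rw [← mapTwo_dOne, hβ, map_zero]
  · obtain ⟨s, hs, E, hE⟩ := exists_smul_derivation_of_isLocalization M (coordField b i)
    set t := algebraMap B R s with ht
    have hpos := (Fact.out : p.Prime).pos
    have hp0 : (p : R) = 0 := by rw [← map_natCast (algebraMap k R), CharP.cast_eq_zero, map_zero]
    have htp : coordField b i (t ^ p) = 0 := by
      rw [Derivation.leibniz_pow, nsmul_eq_mul, hp0, zero_mul]
    -- The denominator is a `p`-th power, so it is a constant for the coordinate field.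
    have h := restrictedContraction_mapOne p (IsScalarTower.toAlgHom k B R) (s ^ (p - 1) • E)
      (t ^ p • coordField b i) (fun c => by
        change t ^ p * coordField b i (algebraMap B R c) = algebraMap B R (s ^ (p - 1) * E c)
        rw [map_mul, map_pow, hE, ← ht, ← mul_assoc, ← pow_succ, Nat.sub_add_cancel hpos]) β
    rw [hβp, map_zero, restrictedContraction_smul_of_apply_eq_zero p _ _ htp] at h
    have hu : IsUnit t := IsLocalization.map_units R (⟨s, hs⟩ : M)
    exact ((hu.pow p).pow p).mul_right_eq_zero.mp h

end Localization

/-! ### Restriction of vector fields to a closed subscheme -/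

section Descent

variable {k A B : Type*} [Field k] [CommRing A] [Algebra k A] [CommRing B] [Algebra k B]

/-- A vector field preserving the ideal of a closed subscheme restricts to the subscheme. -/
lemma exists_derivation_descend (φ : A →ₐ[k] B) (hφ : Function.Surjective φ)
    (D : Derivation k A A) (hD : ∀ a, φ a = 0 → φ (D a) = 0) :
    ∃ E : Derivation k B B, ∀ a, E (φ a) = φ (D a) := by
  have hwd : ∀ a a', φ a = φ a' → φ (D a) = φ (D a') := fun a a' h => by
    rw [← sub_eq_zero, ← map_sub, ← map_sub]
    exact hD _ (by rw [map_sub, h, sub_self])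
  let σ := Function.surjInv hφ
  have hσ : ∀ b, φ (σ b) = b := Function.surjInv_eq hφ
  let L : B →ₗ[k] B :=
    { toFun := fun b => φ (D (σ b))
      map_add' := fun b c => by
        rw [← map_add, ← map_add]; exact hwd _ _ (by simp only [map_add, hσ])
      map_smul' := fun r b => by
        rw [RingHom.id_apply, ← map_smul, ← Derivation.map_smul]
        exact hwd _ _ (by simp only [map_smul, hσ]) }
  have hL : ∀ a, L (φ a) = φ (D a) := fun a => hwd _ _ (hσ _)
  refine ⟨Derivation.mk' L fun b c => ?_, hL⟩
  obtain ⟨b, rfl⟩ := hφ b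
  obtain ⟨c, rfl⟩ := hφ c
  rw [← map_mul, hL, hL, hL, Derivation.leibniz]
  simp only [smul_eq_mul, map_add, map_mul]

end Descent

/-! ### Schemes -/

section Schemes

variable {k : Type u} [Field k] {X Y : Scheme.{u}} (f : X ⟶ Spec (.of k))

lemma smooth_sec [Smooth f] {U : X.Opens} (hU : IsAffineOpen U) : Algebra.Smooth k (Sec f U) := by
  have h1 := Smooth.smooth_appLE f (isAffineOpen_top _) hU (e := le_top)
  have h2 : toSec f U = (Scheme.ΓSpecIso (.of k)).inv ≫ f.appLE ⊤ U le_top := by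
    simp [toSec, Scheme.Hom.appLE]
  have h3 : (toSec f U).hom.Smooth := by
    rw [h2]
    exact RingHom.Smooth.respectsIso.2 (f.appLE ⊤ U le_top).hom
      (Scheme.ΓSpecIso (.of k)).symm.commRingCatIsoToRingEquiv h1
  exact h3

/-- The stalk at a point of an affine open is a localization of the ring of functions. The submonoid
is the complement of the prime ideal of `x`, but only its existence matters. -/
lemma exists_isLocalization_germ {U : X.Opens} (hU : IsAffineOpen U) (x : X) (h : x ∈ U) :
    letI := (germ f U x h).toRingHom.toAlgebra
    ∃ M : Submonoid (Sec f U), IsLocalization M (Stalk f x) := by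
  let := X.presheaf.algebra_section_stalk ⟨x, h⟩
  exact ⟨_, hU.isLocalization_stalk ⟨x, h⟩⟩

lemma pull_surjective (i : Y ⟶ X) [IsClosedImmersion i] {U : X.Opens} (hU : IsAffineOpen U) :
    Function.Surjective (pull f i U) :=
  Scheme.Hom.app_surjective i U hU

lemma res_self (U : X.Opens) (a : Sec f U) : res f le_rfl a = a := by
  change (X.presheaf.map (𝟙 _)).hom a = a
  rw [X.presheaf.map_id]; rfl

lemma mapOne_pullGerm_germ (i : Y ⟶ X) (U : X.Opens) (y : Y) (h : i y ∈ U) (α : Ω[Sec f U⁄k]) :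
    mapOne (pullGerm f i y) (mapOne (germ f U (i y) h) α) =
      mapOne (germ (i ≫ f) (i ⁻¹ᵁ U) y h) (mapOne (pull f i U) α) := by
  rw [mapOne_comp _ _ ((pullGerm f i y).comp (germ f U (i y) h)) (fun _ => rfl),
    mapOne_comp _ _ ((pullGerm f i y).comp (germ f U (i y) h))
      (fun a => (pullGerm_germ f i U y h a).symm)]

/-- The class `[η]` vanishes on `Y` at `y` if and only if the restriction to `Y` of a `1`-form
representing it near `y` is exact in the local ring at `y`. -/
lemma pullback_apply_eq_zero_iff (i : Y ⟶ X) (η : TruncH1 f) (U : X.Opens) (α : Ω[Sec f U⁄k])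
    (hα : Represents f η.1 U α) (y : Y) (h : i y ∈ U) :
    (TruncH1.pullback f i η).1 y = 0 ↔ ∃ g, KaehlerDifferential.D k (Stalk (i ≫ f) y) g =
      mapOne (germ (i ≫ f) (i ⁻¹ᵁ U) y h) (mapOne (pull f i U) α) := by
  change Submodule.mapQ _ _ (mapOne (pullGerm f i y)) (exactGerms_le f i y) (η.1 (i y)) = 0 ↔ _
  rw [hα _ h, ← mapOne_pullGerm_germ]
  change Submodule.Quotient.mk _ = 0 ↔ _
  rw [Submodule.Quotient.mk_eq_zero]
  exact Iff.rfl

variable {f} (p : ℕ) [Fact p.Prime] [CharP k p]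

lemma res_restrictedPower {ω : TwoForm f} (hω : ω.IsSymplectic) (η : TruncH1 f) (U : X.Opens)
    (a : Sec f U) (V : X.affineOpens) (h : V.1 ≤ U) (α : Ω[Sec f V⁄k])
    (hα : Represents f η.1 V α) :
    res f h (restrictedPower p hω η U a) =
      restrictedContraction p (hamiltonian hω V (res f h a)) α :=
  (existsUnique_restrictedPower p hω η U a).choose_spec.1 V h α hα

lemma pull_res (i : Y ⟶ X) {U V : X.Opens} (h : V ≤ U) (a : Sec f U) :
    pull f i V (res f h a) = res (i ≫ f) ((Opens.map i.base).monotone h) (pull f i U a) :=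
  congr($(i.naturality (homOfLE h).op).hom a)

/-- If `I` is stable under the restricted operation, the restriction to `Y` of a local potential
has zero restricted contraction with every vector field, as these are all Hamiltonian. -/
lemma restrictedContraction_pull_eq_zero [Smooth f] {ω : TwoForm f} (hω : ω.IsSymplectic)
    (η : TruncH1 f) (i : Y ⟶ X) [IsClosedImmersion i]
    (hiso : ∀ U : X.affineOpens, mapTwo (pull f i U) (ω.val U) = 0)
    (hI : ∀ (U : X.Opens) (a : Sec f U), a ∈ idealOf f i U →
      restrictedPower p hω η U a ∈ idealOf f i U)
    (U : X.affineOpens) (α : Ω[Sec f U⁄k]) (hα : Represents f η.1 U α)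
    (E : VectorField (i ≫ f) (i ⁻¹ᵁ U.1)) :
    restrictedContraction p E (mapOne (pull f i U) α) = 0 := by
  have := smooth_sec f U.2
  obtain ⟨a, ha, hlift⟩ := exists_hamiltonian_lift (pull f i U) (pull_surjective f i U.2)
    (ω.val U) (hω.nondegenerate U) (hiso U) E
  have h1 := res_restrictedPower p hω η U a U le_rfl α hα
  rw [res_self, res_self] at h1
  rw [restrictedContraction_mapOne p _ _ E (hlift _ (hamiltonian_spec hω U a)), ← h1]
  exact RingHom.mem_ker.mp (hI U a ha)

/-- The restriction of a local potential to `Y` is closed, as `Y` is isotropic, and is annihilated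
by all restricted contractions, so it is locally exact. -/
lemma pullback_eq_zero_of_stable [Smooth f] {ω : TwoForm f} (hω : ω.IsSymplectic) (η : TruncH1 f)
    (hη : IsPotential η ω) (i : Y ⟶ X) [IsClosedImmersion i] [Smooth (i ≫ f)]
    (hiso : ∀ U : X.affineOpens, mapTwo (pull f i U) (ω.val U) = 0)
    (hI : ∀ (U : X.Opens) (a : Sec f U), a ∈ idealOf f i U →
      restrictedPower p hω η U a ∈ idealOf f i U) :
    TruncH1.pullback f i η = 0 := by
  refine Subtype.ext (funext fun y => ?_)
  obtain ⟨U, hU, α, hα⟩ := η.2 (i y)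
  refine (pullback_apply_eq_zero_iff f i η U α hα y hU).mpr ?_
  have hV : IsAffineOpen (i ⁻¹ᵁ U.1) := U.2.preimage i
  have := smooth_sec (i ≫ f) hV
  let := (germ (i ≫ f) (i ⁻¹ᵁ U.1) y hU).toRingHom.toAlgebra
  have : IsScalarTower k (Sec (i ≫ f) (i ⁻¹ᵁ U.1)) (Stalk (i ≫ f) y) :=
    IsScalarTower.of_algebraMap_eq fun r => ((germ (i ≫ f) (i ⁻¹ᵁ U.1) y hU).commutes r).symm
  obtain ⟨M, hM⟩ := exists_isLocalization_germ (i ≫ f) hV y hU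
  have : IsLocalRing (Stalk (i ≫ f) y) := inferInstanceAs (IsLocalRing (Y.presheaf.stalk y))
  refine exists_D_eq_mapOne_of_isLocalization p M (mapOne (pull f i U) α) ?_
    (restrictedContraction_pull_eq_zero p hω η i hiso hI U α hα)
  rw [← mapTwo_dOne, hη U α hα, hiso]

/-- For `a ∈ I` the field `H_a` is tangent to `Y`, as `Y` is coisotropic, so the restriction of
`a^[p]` to `Y` is the restricted contraction of a locally exact form, hence zero. -/
lemma restrictedPower_mem_of_pullback_eq_zero {ω : TwoForm f} (hω : ω.IsSymplectic)
    (η : TruncH1 f) (i : Y ⟶ X) [IsClosedImmersion i] (hY : IsLagrangian hω i)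
    (h0 : TruncH1.pullback f i η = 0) (U : X.Opens) (a : Sec f U) (ha : a ∈ idealOf f i U) :
    restrictedPower p hω η U a ∈ idealOf f i U := by
  refine RingHom.mem_ker.mpr (sec_ext (i ≫ f) _ _ _ fun y hy => ?_)
  obtain ⟨V₀, hV₀, α, hα⟩ := η.2 (i y)
  obtain ⟨V, hV, hVle⟩ := exists_affine_le (U := U ⊓ V₀.1) ⟨hy, hV₀⟩
  have hVU := hVle.trans inf_le_left
  have hα' := hα.res f (hVle.trans inf_le_right)
  set α' := mapOne (res f (hVle.trans inf_le_right)) α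
  set H := hamiltonian hω V (res f hVU a)
  have haV : res f hVU a ∈ idealOf f i V := by
    refine RingHom.mem_ker.mpr ?_
    rw [pull_res, RingHom.mem_ker.mp ha, map_zero]
  obtain ⟨E, hE⟩ := exists_derivation_descend (pull f i V) (pull_surjective f i V.2) H
    fun c hc => hY.coisotropic V _ c haV (RingHom.mem_ker.mpr hc)
  obtain ⟨F, hF⟩ := exists_extend (germ (i ≫ f) (i ⁻¹ᵁ V.1) y hV)
    (formallyEtale_germ (i ≫ f) (V.2.preimage i) y hV) E
  obtain ⟨g, hg⟩ := (pullback_apply_eq_zero_iff f i η V α' hα' y hV).mp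
    (by rw [h0]; rfl)
  rw [map_zero, ← pullGerm_germ f i U y hy, ← res_germ f hVU (i y) hV,
    res_restrictedPower p hω η U a V hVU α' hα', pullGerm_germ f i V y hV,
    ← restrictedContraction_mapOne p _ H E hE, ← restrictedContraction_mapOne p _ E F hF, ← hg,
    restrictedContraction_D]

end Schemes
end RestrictedSymplectic

theorem mainTheorem9 {k : Type u} [Field k] (p : ℕ) [Fact p.Prime] [CharP k p] (hp : 2 < p)
    {X Y : Scheme.{u}} (f : X ⟶ Spec (.of k)) [Smooth f]
    (ω : TwoForm f) (hω : ω.IsSymplectic) (η : TruncH1 f) (hη : IsPotential η ω)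
    (i : Y ⟶ X) [IsClosedImmersion i] [Smooth (i ≫ f)] (hY : IsLagrangian hω i) :
    (∀ (U : X.Opens) (a : Sec f U), a ∈ idealOf f i U →
        restrictedPower p hω η U a ∈ idealOf f i U) ↔
      TruncH1.pullback f i η = 0 :=
  ⟨pullback_eq_zero_of_stable p hω η hη i hY.isotropic,
    fun h U a ha => restrictedPower_mem_of_pullback_eq_zero p hω η i hY h U a ha⟩
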